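/- Let $p$ be a normalized complex polynomial of degree $d\ge 2$, i.e. $p$ is monic and its centroid is $0$ (the coefficient of $z^{d-1}$ vanishes). Suppose that $p(z)=z^{\alpha}p_0(z^{\beta})$, where $\alpha\ge 0$ and $\beta\geq 2$ are integers which are maximal for this form, i.e. $p_0$ is a monic polynomial, $p_0(0)\neq 0$, and the positive exponents $m$ of the monomials $z^m$ occurring in $p_0$ exist and have greatest common divisor $1$. Let $\mathcal J(f)\subset\widehat{\mathbb C}$ denote the Julia set of a polynomial $f$, that is, the complement of the largest open subset of $\widehat{\mathbb C}$ on which the family of iterates $\{f^n\}_{n>0}$ is equicontinuous, and let $\Sigma p$ be the group of all maps $\sigma(z)=az+b$ with $|a|=1$ and $\sigma(\mathcal J(p))=\mathcal J(p)$. Assume $\alpha\neq 1$ and $\beta\nmid(\alpha-1)^2$. For $\sigma\in\Sigma p$ put $q_\sigma=\sigma\circ p\circ\sigma^{-1}$. Then: 1. $\mathcal J(q_\sigma)=\mathcal J(p)$ for every non-identity $\sigma\in\Sigma p$. 2. $q_\sigma\circ p\neq p\circ q_\sigma$ for every $\sigma\in\Sigma p$ of order exactly $\beta$ (a primitive rotation);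 more generally, $q_\sigma\circ p\neq p\circ q_\sigma$ for every $\sigma\in\Sigma p$ whose $(\alpha-1)^2$-th iterate is not the identity. 3. $\Sigma p$ contains an element of order exactly $\beta$. -/

import Mathlib

open Polynomial

/-- The Fatou set of a self-map `f` of the Riemann sphere `OnePoint ℂ`: the largest open set on which
the iterates `fⁿ`, `n > 0`, are equicontinuous. The sphere is compact Hausdorff, so its topology has a
unique compatible uniform structure (the one of the chordal metric), and equicontinuity refers to it. -/
def fatouSet (f : OnePoint ℂ → OnePoint ℂ) : Set (OnePoint ℂ) :=
  letI : UniformSpace (OnePoint ℂ) := uniformSpaceOfCompactR1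
  ⋃₀ {U | IsOpen U ∧ EquicontinuousOn (fun n : ℕ => f^[n + 1]) U}

/-- The Julia set (a subset of the Riemann sphere) of a polynomial map `f : ℂ → ℂ`, which is extended
to the sphere by `∞ ↦ ∞`. -/
def juliaSet (f : ℂ → ℂ) : Set (OnePoint ℂ) :=
  (fatouSet (OnePoint.map f))ᶜ

/-- The symmetry group `Σp`: the Euclidean isometries `σ(z) = az + b`, `|a| = 1`, with
`σ(J(p)) = J(p)`. -/
def juliaSymmetries (p : ℂ[X]) : Set (Equiv.Perm ℂ) :=
  {σ | (∃ a b : ℂ, ‖a‖ = 1 ∧ ∀ z, σ z = a * z + b) ∧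
    OnePoint.map σ '' juliaSet (fun z => p.eval z) = juliaSet (fun z => p.eval z)}

/-- The centroid `-a_{d-1} / (d a_d)` of a polynomial of degree `d ≥ 1`. -/
noncomputable def centroid (p : ℂ[X]) : ℂ :=
  -p.coeff (p.natDegree - 1) / (p.natDegree * p.leadingCoeff)

/-- Normalized polynomials: monic and centered. -/
def IsNormalized (p : ℂ[X]) : Prop :=
  p.Monic ∧ centroid p = 0

/-- `p(z) = z^α p₀(z^β)` with `α`, `β` maximal: `p₀` is monic with `p₀(0) ≠ 0`, and the exponents of
the monomials occurring in `p₀` have greatest common divisor `1` (the exponent `0` does not affect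
the gcd, and the gcd is `0` if `p₀` is constant). -/
def HasNormalForm (p : ℂ[X]) (α β : ℕ) (p₀ : ℂ[X]) : Prop :=
  p = X ^ α * p₀.comp (X ^ β) ∧ p₀.Monic ∧ p₀.eval 0 ≠ 0 ∧ p₀.support.gcd id = 1

/-- The conjugate `σ ∘ p ∘ σ⁻¹` as a map of the plane. -/
def conjMap (σ : Equiv.Perm ℂ) (p : ℂ[X]) : ℂ → ℂ :=
  fun z => σ (p.eval (σ⁻¹ z))

/-! ### Equicontinuity domains of semiconjugate iterates -/

/-! Conjugacy by a homeomorphism of the sphere carries Fatou set to Fatou set, so `J(q_σ) = σ(J(p))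
= J(p)`. If `w^β = 1`, then `p^n(wz) = w^(α^n) p^n(z)`; only finitely many rotations occur as
factors, so they preserve equicontinuity and `z ↦ wz` is a symmetry.

For non-commutation, rigidity is decisive: a polynomial of degree `d` commuting with a monic
centered `p` of degree `d ≥ 2` is a multiple of `p` (`eq_C_mul_of_comp_comm`). If `σ p σ⁻¹` commutes
with `p`, centering then forces `σ z = a z`, and comparing coefficients gives `a^β = 1`. So the
conjugate is `w p` with `w = a^(1-α)`; commuting means `w^α = w`, whence `a^((α-1)^2) = 1`. -/

theorem EquicontinuousOn.comp_homeomorph_of_uniformEquicontinuous {ι X Y Z : Type*}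
    [TopologicalSpace X] [UniformSpace Y] [UniformSpace Z] {F : ι → X → Y} {U : Set X}
    (hF : EquicontinuousOn F U) {k : ι → Y → Z} (hk : UniformEquicontinuous k) (h : X ≃ₜ X) :
    EquicontinuousOn (fun n => k n ∘ F n ∘ h) (h ⁻¹' U) := by
  intro x hx V hV
  have h1 := hF (h x) hx _ (hk V hV)
  have h2 : Filter.Tendsto h (nhdsWithin x (h ⁻¹' U)) (nhdsWithin (h x) U) :=
    h.continuous.continuousWithinAt.tendsto_nhdsWithin (fun _ hy => hy)
  filter_upwards [h2.eventually h1] with y hy n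
  exact hy n n

/-- A finite family of continuous maps of the compact sphere is uniformly equicontinuous, so the
outer factor may vary with `n`. This covers both conjugacies and rotations by roots of unity. -/
theorem preimage_fatouSet_subset {f g : OnePoint ℂ → OnePoint ℂ} (h : OnePoint ℂ ≃ₜ OnePoint ℂ)
    {κ : Type*} [Finite κ] (K : κ → OnePoint ℂ → OnePoint ℂ) (hK : ∀ i, Continuous (K i))
    (u : ℕ → κ) (hg : ∀ n, g^[n + 1] = K (u n) ∘ f^[n + 1] ∘ h) :
    h ⁻¹' fatouSet f ⊆ fatouSet g := by
  let _ : UniformSpace (OnePoint ℂ) := uniformSpaceOfCompactR1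
  rintro x ⟨U, ⟨hU, hfU⟩, hx⟩
  have hKe : UniformEquicontinuous K := uniformEquicontinuous_finite.2 fun i =>
    CompactSpace.uniformContinuous_of_continuous (hK i)
  refine ⟨h ⁻¹' U, ⟨hU.preimage h.continuous, ?_⟩, hx⟩
  have := EquicontinuousOn.comp_homeomorph_of_uniformEquicontinuous hfU (hKe.comp u) h
  convert this using 2 with n
  exact hg n

theorem preimage_fatouSet_subset_of_conj {f g : OnePoint ℂ → OnePoint ℂ}
    (h : OnePoint ℂ ≃ₜ OnePoint ℂ) (hg : Function.Semiconj h g f) :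
    h ⁻¹' fatouSet f ⊆ fatouSet g := by
  refine preimage_fatouSet_subset h (fun _ : Unit => h.symm) (fun _ => h.symm.continuous)
    (fun _ => ()) fun n => funext fun x => ?_
  simp [← (hg.iterate_right (n + 1)).eq x, -Function.iterate_succ]

theorem fatouSet_conj {f g : OnePoint ℂ → OnePoint ℂ}
    (h : OnePoint ℂ ≃ₜ OnePoint ℂ) (hg : Function.Semiconj h f g) :
    fatouSet g = h '' fatouSet f := by
  have hg' : Function.Semiconj h.symm g f := fun x => by
    rw [Homeomorph.symm_apply_eq, hg.eq, h.apply_symm_apply]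
  apply subset_antisymm
  · intro x hx
    refine ⟨h.symm x, preimage_fatouSet_subset_of_conj h hg ?_, h.apply_symm_apply x⟩
    simpa using hx
  · rw [h.image_eq_preimage_symm]
    exact preimage_fatouSet_subset_of_conj h.symm hg'

/-! ### Affine isometries of the plane acting on the sphere -/

theorem exists_homeomorph_onePointMap {σ : Equiv.Perm ℂ} {a b : ℂ} (ha : a ≠ 0)
    (hσ : ∀ z, σ z = a * z + b) :
    ∃ h : OnePoint ℂ ≃ₜ OnePoint ℂ, ⇑h = OnePoint.map σ := by
  have hinv : ∀ z, σ.symm z = a⁻¹ * (z - b) := fun z => by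
    rw [Equiv.symm_apply_eq, hσ, mul_inv_cancel_left₀ ha, sub_add_cancel]
  refine ⟨Homeomorph.onePointCongr ⟨σ, ?_, ?_⟩, rfl⟩
  · change Continuous σ
    rw [funext hσ]; fun_prop
  · change Continuous σ.symm
    rw [funext hinv]; fun_prop

theorem juliaSet_conjMap {p : ℂ[X]} {σ : Equiv.Perm ℂ} (hσ : σ ∈ juliaSymmetries p) :
    juliaSet (conjMap σ p) = juliaSet (fun z => p.eval z) := by
  obtain ⟨⟨a, b, ha, hab⟩, hJ⟩ := hσ
  obtain ⟨h, hh⟩ := exists_homeomorph_onePointMap (norm_ne_zero_iff.1 (by simp [ha])) hab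
  rw [← hJ, ← hh, juliaSet, juliaSet, Set.image_compl_eq h.bijective, fatouSet_conj h]
  intro x
  rw [hh]
  induction x using OnePoint.rec with
  | infty => rfl
  | coe z => simp [conjMap]

/-! ### Rotations by roots of unity as symmetries -/

theorem eval_mul_of_pow_eq_one {p p₀ : ℂ[X]} {α β : ℕ}
    (hp : p = X ^ α * p₀.comp (X ^ β)) {w : ℂ} (hw : w ^ β = 1) (z : ℂ) :
    p.eval (w * z) = w ^ α * p.eval z := by
  simp [hp, mul_pow, hw, mul_assoc]

theorem iterate_eval_mul {p p₀ : ℂ[X]} {α β : ℕ}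
    (hp : p = X ^ α * p₀.comp (X ^ β)) {w : ℂ} (hw : w ^ β = 1) (n : ℕ) (z : ℂ) :
    (fun z => p.eval z)^[n] (w * z) = w ^ α ^ n * (fun z => p.eval z)^[n] z := by
  induction n with
  | zero => simp
  | succ n ih =>
    rw [Function.iterate_succ_apply', ih, Function.iterate_succ_apply',
      eval_mul_of_pow_eq_one hp (by rw [← pow_mul, mul_comm, pow_mul, hw, one_pow]), ← pow_mul,
      pow_succ]

/-- The rotation `z ↦ u z` of the plane. -/
def rotationPerm : ℂˣ →* Equiv.Perm ℂ := MulAction.toPermHom ℂˣ ℂ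

theorem rotationPerm_apply (u : ℂˣ) (z : ℂ) : rotationPerm u z = u * z := rfl

theorem rotationPerm_injective : Function.Injective rotationPerm := fun u v h => by
  simpa [rotationPerm_apply, Units.ext_iff] using DFunLike.congr_fun h 1

theorem onePointMap_iterate {X : Type*} (f : X → X) (n : ℕ) :
    (OnePoint.map f)^[n] = OnePoint.map f^[n] := by
  induction n with
  | zero => simp
  | succ n ih => rw [Function.iterate_succ, Function.iterate_succ, ih, OnePoint.map_comp]

theorem preimage_rotation_fatouSet_subset {p p₀ : ℂ[X]} {α β : ℕ} (hβ : β ≠ 0)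
    (hp : p = X ^ α * p₀.comp (X ^ β)) {u : ℂˣ} (hu : u ∈ rootsOfUnity β ℂ) :
    OnePoint.map (rotationPerm u) ⁻¹' fatouSet (OnePoint.map fun z => p.eval z) ⊆
      fatouSet (OnePoint.map fun z => p.eval z) := by
  have : NeZero β := ⟨hβ⟩
  have hrot (v : ℂˣ) := exists_homeomorph_onePointMap (σ := rotationPerm v) (b := 0) v.ne_zero
    (fun z => by simp [rotationPerm_apply])
  obtain ⟨h, hh⟩ := hrot u
  rw [← hh]
  refine preimage_fatouSet_subset h
    (fun v : rootsOfUnity β ℂ => OnePoint.map (rotationPerm (v : ℂˣ)))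
    (fun v => ?_) (fun n => ⟨u, hu⟩⁻¹ ^ α ^ (n + 1)) fun n => ?_
  · obtain ⟨k, hk⟩ := hrot v
    exact hk ▸ k.continuous
  · rw [onePointMap_iterate, hh, ← OnePoint.map_comp, ← OnePoint.map_comp]
    congr 1
    funext z
    have hu' : (u : ℂ) ^ β = 1 := by simpa [← Units.val_pow_eq_pow_val] using hu
    simp only [Function.comp_apply, rotationPerm_apply, iterate_eval_mul hp hu']
    simp

theorem rotationPerm_mem_juliaSymmetries {p p₀ : ℂ[X]} {α β : ℕ} (hβ : β ≠ 0)
    (hp : p = X ^ α * p₀.comp (X ^ β)) {u : ℂˣ} (hu : u ∈ rootsOfUnity β ℂ) :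
    rotationPerm u ∈ juliaSymmetries p := by
  have hu' : (u : ℂ) ^ β = 1 := by simpa [← Units.val_pow_eq_pow_val] using hu
  refine ⟨⟨u, 0, Complex.norm_eq_one_of_pow_eq_one hu' hβ, fun z => by
    simp [rotationPerm_apply]⟩, ?_⟩
  obtain ⟨h, hh⟩ := exists_homeomorph_onePointMap (σ := rotationPerm u) (b := 0) u.ne_zero
    (fun z => by simp [rotationPerm_apply])
  have h1 := preimage_rotation_fatouSet_subset hβ hp hu
  have h2 := preimage_rotation_fatouSet_subset hβ hp (inv_mem hu)
  have hsymm : OnePoint.map (rotationPerm u⁻¹) = h.symm := by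
    funext x
    apply h.injective
    rw [h.apply_symm_apply, hh, ← Function.comp_apply (f := OnePoint.map _),
      ← OnePoint.map_comp, ← Equiv.Perm.coe_mul, ← map_mul]
    simp
  rw [hsymm, ← h.image_eq_preimage_symm] at h2
  rw [← hh] at h1 ⊢
  rw [juliaSet, Set.image_compl_eq h.bijective, compl_inj_iff]
  refine h2.antisymm fun x hx => ⟨h.symm x, h1 ?_, h.apply_symm_apply x⟩
  simpa using hx

theorem exists_juliaSymmetries_orderOf_eq {p p₀ : ℂ[X]} {α β : ℕ} (hβ : β ≠ 0)
    (hp : p = X ^ α * p₀.comp (X ^ β)) : ∃ σ ∈ juliaSymmetries p, orderOf σ = β := by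
  have hζ := Complex.isPrimitiveRoot_exp β hβ
  obtain ⟨u, hu⟩ := hζ.isUnit hβ
  rw [← hu, IsPrimitiveRoot.coe_units_iff] at hζ
  refine ⟨rotationPerm u, rotationPerm_mem_juliaSymmetries hβ hp hζ.pow_eq_one, ?_⟩
  rw [orderOf_injective _ rotationPerm_injective, hζ.eq_orderOf]

/-! ### Commuting polynomials of the same degree -/

/-- All `d` summands share their degree and leading coefficient, so nothing cancels in
characteristic zero. -/
theorem natDegree_geom_sum₂ {q r : ℂ[X]} {d : ℕ} (hd : d ≠ 0) (hq : q ≠ 0)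
    (hdeg : q.natDegree = r.natDegree) (hlead : q.leadingCoeff = r.leadingCoeff) :
    (∑ i ∈ Finset.range d, q ^ i * r ^ (d - 1 - i)).natDegree = (d - 1) * q.natDegree := by
  apply natDegree_eq_of_le_of_coeff_ne_zero
  · refine natDegree_sum_le_of_forall_le _ _ fun i hi => ?_
    rw [Finset.mem_range] at hi
    refine natDegree_mul_le.trans ((add_le_add natDegree_pow_le natDegree_pow_le).trans ?_)
    rw [← hdeg, ← add_mul]
    exact Nat.mul_le_mul_right _ (by omega)
  · have : ∀ i ∈ Finset.range d, (q ^ i * r ^ (d - 1 - i)).coeff ((d - 1) * q.natDegree) =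
        q.leadingCoeff ^ (d - 1) := fun i hi => by
      rw [Finset.mem_range] at hi
      have hr : r ≠ 0 := by rwa [← leadingCoeff_ne_zero, ← hlead, leadingCoeff_ne_zero]
      have : (d - 1) * q.natDegree = (q ^ i * r ^ (d - 1 - i)).natDegree := by
        rw [natDegree_mul (pow_ne_zero _ hq) (pow_ne_zero _ hr), natDegree_pow, natDegree_pow,
          ← hdeg, ← add_mul]
        congr 1; omega
      rw [this, coeff_natDegree, leadingCoeff_mul, leadingCoeff_pow, leadingCoeff_pow, ← hlead,
        ← pow_add]
      congr 1; omega
    rw [finsetSum_coeff, Finset.sum_congr rfl this]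
    simp [hd, hq]

/-- A polynomial of the same degree commuting with a monic polynomial `p` is `c p + e`. -/
theorem eq_C_mul_add_C_of_comp_comm {p q : ℂ[X]} (hp : p.Monic) (hd : 2 ≤ p.natDegree)
    (hq : q.natDegree = p.natDegree) (hcomm : p.comp q = q.comp p) :
    ∃ e : ℂ, q = C q.leadingCoeff * p + C e := by
  set d := p.natDegree with hdp
  set c := q.leadingCoeff with hc
  have hq0 : q ≠ 0 := fun h => by simp [h] at hq; omega
  have hc0 : c ≠ 0 := leadingCoeff_ne_zero.2 hq0
  have hcd : c ^ d = c := by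
    have := congrArg leadingCoeff hcomm
    rw [leadingCoeff_comp (by omega), leadingCoeff_comp (by omega), hp.leadingCoeff, one_pow,
      one_mul, mul_one] at this
    exact this
  -- Without its leading term, `f` has degree at most `d - 1`.
  have hexp (f g : ℂ[X]) (hf : f.natDegree = d) (hg : g.natDegree = d) :
      (f.comp g - C f.leadingCoeff * g ^ d).natDegree ≤ (d - 1) * d := by
    have : f.comp g - C f.leadingCoeff * g ^ d = f.eraseLead.comp g := by
      rw [sub_eq_iff_eq_add]
      conv_lhs => rw [← eraseLead_add_C_mul_X_pow f]
      simp [hf]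
    rw [this, natDegree_comp, hg]
    exact Nat.mul_le_mul_right _ (hf ▸ eraseLead_natDegree_le f)
  have h1 := hexp p q rfl hq
  have h2 := hexp q p hq rfl
  rw [hp.leadingCoeff, hcomm] at h1
  have h3 : (q ^ d - (C c * p) ^ d).natDegree ≤ (d - 1) * d := by
    have : q ^ d - (C c * p) ^ d =
        (q.comp p - C c * p ^ d) - (q.comp p - C 1 * q ^ d) := by
      rw [mul_pow, ← C_pow, hcd]; simp
    rw [this]
    exact (natDegree_sub_le _ _).trans (max_le h2 h1)
  have hlead : q.leadingCoeff = (C c * p).leadingCoeff := by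
    simp [hp.leadingCoeff, hc]
  have hdeg : q.natDegree = (C c * p).natDegree := by rw [natDegree_C_mul hc0, hq]
  have hS := natDegree_geom_sum₂ (d := d) (by omega) hq0 hdeg hlead
  -- In `q^d - (cp)^d` the geometric-sum factor already has degree `(d - 1) * d`, so the other
  -- factor is constant.
  have h4 : (q - C c * p).natDegree = 0 := by
    by_contra hne
    have hne' : q - C c * p ≠ 0 := fun h => by simp [h] at hne
    have hS0 : (∑ i ∈ Finset.range d, q ^ i * (C c * p) ^ (d - 1 - i)) ≠ 0 := fun h => by
      rw [h, natDegree_zero, hq] at hS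
      have : 0 < (d - 1) * d := Nat.mul_pos (by omega) (by omega)
      omega
    rw [← Commute.geom_sum₂_mul (Commute.all _ _), natDegree_mul hS0 hne', hS, hq] at h3
    omega
  obtain ⟨e, he⟩ := natDegree_eq_zero.1 h4
  exact ⟨e, by rw [he]; ring⟩

/-- Centering leaves degree at most `d - 2` below the leading term, so only the binomial expansion
of the latter contributes. This coefficient detects the translation `b`. -/
theorem coeff_comp_linear {p : ℂ[X]} (hd : 2 ≤ p.natDegree)
    (hcoeff : p.coeff (p.natDegree - 1) = 0) (a b : ℂ) :
    (p.comp (C a * X + C b)).coeff (p.natDegree - 1) =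
      p.leadingCoeff * (a ^ (p.natDegree - 1) * (p.natDegree * b)) := by
  have hdeg : (p.eraseLead.comp (C a * X + C b)).natDegree < p.natDegree - 1 := by
    have h1 := natDegree_eraseLead_le_of_nextCoeff_eq_zero
      (f := p) (by rw [nextCoeff_of_natDegree_pos (by omega), hcoeff])
    have h2 : (C a * X + C b).natDegree ≤ 1 := natDegree_linear_le
    rw [natDegree_comp]
    have := Nat.mul_le_mul h1 h2
    omega
  have hlin : ((C a * X + C b) ^ p.natDegree).coeff (p.natDegree - 1) =
      a ^ (p.natDegree - 1) * (p.natDegree * b) := by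
    have : (C a * X + C b) ^ p.natDegree = ((X + C b) ^ p.natDegree).comp (C a * X) := by simp
    rw [this, comp_C_mul_X_coeff, coeff_X_add_C_pow, Nat.choose_symm (by omega),
      show p.natDegree - (p.natDegree - 1) = 1 by omega, Nat.choose_one_right]
    ring
  conv_lhs => rw [← eraseLead_add_C_mul_X_pow p]
  rw [add_comp, coeff_add, mul_comp, C_comp, pow_comp, X_comp, coeff_C_mul]
  rw [eraseLead_add_C_mul_X_pow, hlin, coeff_eq_zero_of_natDegree_lt hdeg, zero_add]

/-- A polynomial of the same degree commuting with a normalized polynomial is a multiple of it. -/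
theorem eq_C_mul_of_comp_comm {p q : ℂ[X]} (hp : p.Monic) (hd : 2 ≤ p.natDegree)
    (hcoeff : p.coeff (p.natDegree - 1) = 0) (hq : q.natDegree = p.natDegree)
    (hcomm : p.comp q = q.comp p) : q = C q.leadingCoeff * p := by
  obtain ⟨e, he⟩ := eq_C_mul_add_C_of_comp_comm hp hd hq hcomm
  have hc0 : q.leadingCoeff ≠ 0 := fun h => by
    rw [leadingCoeff_eq_zero] at h
    simp [h] at hq; omega
  generalize q.leadingCoeff = c at he hc0 ⊢
  -- The nonconstant inner `p` cancels on the right.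
  have hcancel : p.comp (C c * X + C e) = C c * p + C e := by
    rw [← sub_eq_zero]
    have : (p.comp (C c * X + C e) - (C c * p + C e)).comp p = 0 := by
      rw [sub_comp, comp_assoc]
      simpa [he, sub_eq_zero] using hcomm
    rcases comp_eq_zero_iff.1 this with h | ⟨-, h⟩
    · exact h
    · have := congrArg natDegree h
      rw [natDegree_C] at this; omega
  have h := coeff_comp_linear hd hcoeff c e
  rw [hcancel, coeff_add, coeff_C_mul, hcoeff, coeff_C_of_ne_zero (by omega), hp.leadingCoeff] at h
  have he0 : e = 0 := by
    have : (p.natDegree : ℂ) ≠ 0 := Nat.cast_ne_zero.2 (by omega)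
    simpa [hc0, this] using h
  rw [he, he0]; simp

/-! ### Commuting conjugates -/

/-- The conjugate of `p` by `z ↦ a z + b`, as a polynomial. -/
noncomputable def affineConj (p : ℂ[X]) (a b : ℂ) : ℂ[X] :=
  C a * p.comp (C a⁻¹ * X + C (-(a⁻¹ * b))) + C b

theorem conjMap_eq_eval_affineConj {p : ℂ[X]} {σ : Equiv.Perm ℂ} {a b : ℂ} (ha : a ≠ 0)
    (hσ : ∀ z, σ z = a * z + b) : conjMap σ p = fun z => (affineConj p a b).eval z := by
  funext z
  have hinv : σ⁻¹ z = a⁻¹ * z + -(a⁻¹ * b) := by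
    rw [Equiv.Perm.inv_eq_iff_eq, hσ]
    field_simp
    ring
  simp [conjMap, affineConj, hinv, hσ]

/-- If the conjugate of a normalized `p` by `z ↦ a z + b` commutes with `p`, then `b = 0` and the
conjugate is a multiple of `p`. -/
theorem affineConj_comp_comm {p : ℂ[X]} (hp : p.Monic) (hd : 2 ≤ p.natDegree)
    (hcoeff : p.coeff (p.natDegree - 1) = 0) {a b : ℂ} (ha : a ≠ 0)
    (hcomm : p.comp (affineConj p a b) = (affineConj p a b).comp p) :
    b = 0 ∧ ∃ c : ℂ, affineConj p a b = C c * p := by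
  have hlin : (C a⁻¹ * X + C (-(a⁻¹ * b))).natDegree = 1 := natDegree_linear (inv_ne_zero ha)
  have hdeg : (affineConj p a b).natDegree = p.natDegree := by
    rw [affineConj, natDegree_add_C, natDegree_C_mul ha, natDegree_comp, hlin, mul_one]
  have hq := eq_C_mul_of_comp_comm hp hd hcoeff hdeg hcomm
  refine ⟨?_, _, hq⟩
  have h := congrArg (fun f => coeff f (p.natDegree - 1)) hq
  simp only [affineConj, coeff_add, coeff_C_mul, hcoeff, coeff_comp_linear hd hcoeff] at h
  rw [coeff_C_of_ne_zero (by omega), hp.leadingCoeff] at h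
  have : (p.natDegree : ℂ) ≠ 0 := Nat.cast_ne_zero.2 (by omega)
  simpa [ha, this] using h

/-- Every exponent `m` of `p` satisfies `a^(1-m) = c`. Comparing `m = βk + α` with `m = α` gives
`(a^β)^k = 1`, so the order of `a^β` divides a gcd equal to `1`. -/
theorem pow_eq_one_of_hasNormalForm {p p₀ : ℂ[X]} {α β : ℕ} (hform : HasNormalForm p α β p₀)
    (hβ : β ≠ 0) {a c : ℂ} (ha : a ≠ 0) (h : affineConj p a 0 = C c * p) : a ^ β = 1 := by
  obtain ⟨hp, -, h0, hgcd⟩ := hform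
  have hcoeff (m : ℕ) (hm : p.coeff m ≠ 0) : a * a⁻¹ ^ m = c := by
    have := congrArg (fun f => coeff f m) h
    simp only [affineConj, mul_zero, neg_zero, C_0, add_zero, coeff_C_mul,
      comp_C_mul_X_coeff] at this
    exact mul_right_cancel₀ hm (by rw [← this]; ring)
  have hp₀ (k : ℕ) : p.coeff (β * k + α) = p₀.coeff k := by
    rw [hp, mul_comm (X ^ α), coeff_mul_X_pow, ← expand_eq_comp_X_pow,
      coeff_expand_mul' (Nat.pos_of_ne_zero hβ)]
  have hα : a * a⁻¹ ^ α = c := hcoeff α (by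
    rw [← zero_add α, ← mul_zero β, hp₀, coeff_zero_eq_eval_zero]; exact h0)
  rw [← orderOf_dvd_iff_pow_eq_one]
  have hdvd : orderOf (a ^ β) ∣ p₀.support.gcd id := Finset.dvd_gcd fun k hk => by
    have hk' := hcoeff (β * k + α) (by rw [hp₀]; exact mem_support_iff.1 hk)
    rw [← hα, pow_add] at hk'
    have h1 : a⁻¹ ^ (β * k) = 1 := by
      have ha' := inv_ne_zero ha
      exact mul_right_cancel₀ (pow_ne_zero α ha') (mul_left_cancel₀ ha (by rw [hk', one_mul]))
    rw [id, orderOf_dvd_iff_pow_eq_one, ← pow_mul, ← inv_eq_one, ← inv_pow, h1]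
  rw [hgcd, Nat.dvd_one, orderOf_eq_one_iff] at hdvd
  exact orderOf_dvd_iff_pow_eq_one.2 hdvd

/-- The exponent is an integer because `α = 0` is allowed, where truncated subtraction would give
`0` instead of `1`. -/
theorem zpow_eq_one_of_conjMap_comp_comm {p p₀ : ℂ[X]} {α β : ℕ} (hdeg : 2 ≤ p.natDegree)
    (hp : IsNormalized p) (hform : HasNormalForm p α β p₀) (hβ : β ≠ 0) {σ : Equiv.Perm ℂ}
    (hσ : σ ∈ juliaSymmetries p)
    (hcomm : conjMap σ p ∘ (fun z => p.eval z) = (fun z => p.eval z) ∘ conjMap σ p) :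
    σ ^ (((α : ℤ) - 1) ^ 2) = 1 := by
  obtain ⟨⟨a, b, ha, hab⟩, -⟩ := hσ
  have ha0 : a ≠ 0 := norm_ne_zero_iff.1 (by simp [ha])
  have hmonic := hp.1
  have hcoeff : p.coeff (p.natDegree - 1) = 0 := by
    have h := hp.2
    have : (p.natDegree : ℂ) ≠ 0 := Nat.cast_ne_zero.2 (by omega)
    simpa [centroid, hmonic.leadingCoeff, this, hmonic.ne_zero] using h
  rw [conjMap_eq_eval_affineConj ha0 hab] at hcomm
  have hcomm' : p.comp (affineConj p a b) = (affineConj p a b).comp p :=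
    Polynomial.funext fun z => by
      simpa using (congrFun hcomm z).symm
  obtain ⟨rfl, c, hc⟩ := affineConj_comp_comm hmonic hdeg hcoeff ha0 hcomm'
  have haβ := pow_eq_one_of_hasNormalForm hform hβ ha0 hc
  have hinvβ : a⁻¹ ^ β = 1 := by rw [inv_pow, haβ, inv_one]
  have hconj : affineConj p a 0 = C (a * a⁻¹ ^ α) * p := Polynomial.funext fun z => by
    simp [affineConj, eval_mul_of_pow_eq_one hform.1 hinvβ, mul_assoc]
  set w := a * a⁻¹ ^ α with hw
  have hwβ : w ^ β = 1 := by
    rw [hw, mul_pow, haβ, ← pow_mul, mul_comm α, pow_mul, hinvβ, one_pow, one_mul]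
  -- Since `w^β = 1`, `p ∘ (w p) = w^α (p ∘ p)`, while `(w p) ∘ p = w (p ∘ p)`.
  have hwα : w ^ α = w := by
    have hne : p.comp p ≠ 0 := fun h => by
      have := natDegree_comp (p := p) (q := p)
      rw [h, natDegree_zero] at this
      have : 0 < p.natDegree * p.natDegree := Nat.mul_pos (by omega) (by omega)
      omega
    rw [hconj] at hcomm'
    have : C (w ^ α) * p.comp p = C w * p.comp p := by
      rw [show C w * p.comp p = (C w * p).comp p by simp, ← hcomm']
      refine Polynomial.funext fun z => ?_
      simp only [eval_mul, eval_comp, eval_C, eval_mul_of_pow_eq_one hform.1 hwβ]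
    exact C_injective (mul_right_cancel₀ hne this)
  have hu : σ = rotationPerm (Units.mk0 a ha0) := Equiv.ext fun z => by
    simp [hab, rotationPerm_apply]
  rw [hu, ← map_zpow, ← map_one rotationPerm]
  congr 1
  ext
  have hwz : w = a ^ (1 - (α : ℤ)) := by
    rw [hw, zpow_sub₀ ha0, zpow_one, zpow_natCast, inv_pow, div_eq_mul_inv]
  have hw0 : w ≠ 0 := hwz ▸ zpow_ne_zero _ ha0
  have : w ^ (1 - (α : ℤ)) = 1 := by
    rw [zpow_sub₀ hw0, zpow_one, zpow_natCast, hwα, div_self hw0]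
  rw [hwz, ← zpow_mul] at this
  rw [Units.val_zpow_eq_zpow_val, Units.val_mk0, Units.val_one, ← this]
  congr 1
  ring

theorem mainTheorem10 (p p₀ : ℂ[X]) (α β : ℕ) (hdeg : 2 ≤ p.natDegree) (hp : IsNormalized p)
    (hform : HasNormalForm p α β p₀) (hα : α ≠ 1) (hβ : 2 ≤ β)
    (hdvd : ¬ (β : ℤ) ∣ ((α : ℤ) - 1) ^ 2) :
    (∃ σ ∈ juliaSymmetries p, orderOf σ = β) ∧
    ∀ σ ∈ juliaSymmetries p, σ ≠ 1 →
      juliaSet (conjMap σ p) = juliaSet (fun z => p.eval z) ∧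
      (orderOf σ = β →
        conjMap σ p ∘ (fun z => p.eval z) ≠ (fun z => p.eval z) ∘ conjMap σ p) ∧
      (σ ^ (((α : ℤ) - 1) ^ 2) ≠ 1 →
        conjMap σ p ∘ (fun z => p.eval z) ≠ (fun z => p.eval z) ∘ conjMap σ p) := by
  have hβ0 : β ≠ 0 := by omega
  refine ⟨exists_juliaSymmetries_orderOf_eq hβ0 hform.1, fun σ hσ _ =>
    ⟨juliaSet_conjMap hσ, fun hord hcomm => hdvd ?_, fun hne hcomm => hne ?_⟩⟩
  · rw [← hord, orderOf_dvd_iff_zpow_eq_one]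
    exact zpow_eq_one_of_conjMap_comp_comm hdeg hp hform hβ0 hσ hcomm
  · exact zpow_eq_one_of_conjMap_comp_comm hdeg hp hform hβ0 hσ hcomm
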